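/- Let $(M,+,0)$ be a commutative monoid and let $M^{(-)}\colon \mathbf{Set}\to\mathbf{Set}$ be the monoid-valued functor: $M^{(X)}$ is the set of functions $\varphi\colon X\to M$ with $\varphi(x)=0$ for all but finitely many $x$, and for $f\colon X\to Y$ the map $M^{(f)}$ sends $\varphi$ to $y\mapsto\sum_{x\in f^{-1}(y)}\varphi(x)$. Call $M$ \emph{positive} if $a+b=0$ implies $a=b=0$, and \emph{refinable} if whenever $a_1+a_2=b_1+b_2$ there are $c_{11},c_{12},c_{21},c_{22}\in M$ with $c_{i1}+c_{i2}=a_i$ and $c_{1j}+c_{2j}=b_j$ for $i,j\in\{1,2\}$. Let $\mathbf{Rel}$ be the category of sets and relations. An \emph{extension} of a functor $F\colon\mathbf{Set}\to\mathbf{Set}$ is a functor $E\colon\mathbf{Rel}\to\mathbf{Rel}$ such that $E\circ G=G\circ F$, where $G\colon\mathbf{Set}\to\mathbf{Rel}$ is the identity on objects and sends each function to its graph. The \emph{Barr extension} of $F$ (which need not be functorial in general) sends a set $X$ to $FX$ and a relation $r\subseteq X\times Y$ with projections $\pi_1\colon r\to X$, $\pi_2\colon r\to Y$ to the relation $\{(F\pi_1(w),F\pi_2(w))\mid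 w\in F(r)\}\subseteq FX\times FY$. Then $M^{(-)}$ admits an extension if and only if $M$ is positive and refinable. In that case the Barr extension of $M^{(-)}$ is an extension of $M^{(-)}$, and it is the only one. -/

import Mathlib

open CategoryTheory

universe u

/-- The monoid-valued functor `M^(-)`: a set `X` is sent to the set of finitely supported functions
`X → M`, and a map `f : X → Y` to the map `φ ↦ (y ↦ ∑ x ∈ f⁻¹ y, φ x)`. -/
noncomputable def monoidValued (M : Type u) [AddCommMonoid M] : Type u ⥤ Type u where
  obj X := X →₀ M
  map f := TypeCat.ofHom fun φ => Finsupp.mapDomain f φ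
  map_id X := by
    refine ConcreteCategory.hom_ext _ _ fun (φ : X →₀ M) => ?_
    exact Finsupp.mapDomain_id
  map_comp {X Y Z} f g := by
    refine ConcreteCategory.hom_ext _ _ fun (φ : X →₀ M) => ?_
    exact Finsupp.mapDomain_comp (f := f) (g := g)

/-- A functor `E : Rel ⥤ Rel` is an extension of `F : Set ⥤ Set` if it commutes (strictly) with
`F` along the graph functor `Set ⥤ Rel`. -/
def IsRelExtension (F : Type u ⥤ Type u) (E : RelCat.{u} ⥤ RelCat.{u}) : Prop :=
  RelCat.graphFunctor ⋙ E = F ⋙ RelCat.graphFunctor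

/-- The action of the Barr extension on a relation `r` from `X` to `Y`: with `π₁ : r → X` and
`π₂ : r → Y` the projections, this is the composite of the converse of the graph of `F π₁` with
the graph of `F π₂`. -/
def barrRel (F : Type u ⥤ Type u) {X Y : Type u} (r : SetRel X Y) :
    SetRel (F.obj X) (F.obj Y) :=
  (Function.graph (F.map (TypeCat.ofHom fun p : r => p.1.1))).inv.comp
    (Function.graph (F.map (TypeCat.ofHom fun p : r => p.1.2)))

/-- The Barr extension of `F`, as an assignment on the objects and the morphisms of `Rel`. It need
not be functorial. -/
def barrExtension (F : Type u ⥤ Type u) : RelCat.{u} ⥤q RelCat.{u} where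
  obj X := RelCat.graphFunctor.obj (F.obj X)
  map r := RelCat.Hom.ofRel (barrRel F r.rel)

/-- `M` is positive: a sum is zero only if both summands are zero. -/
def IsPositiveMonoid (M : Type u) [AddCommMonoid M] : Prop :=
  ∀ a b : M, a + b = 0 → a = 0 ∧ b = 0

/-- `M` is refinable: whenever `a₁ + a₂ = b₁ + b₂`, there is a `2 × 2` matrix over `M` with row
sums `a₁, a₂` and column sums `b₁, b₂`. -/
def IsRefinableMonoid (M : Type u) [AddCommMonoid M] : Prop :=
  ∀ a₁ a₂ b₁ b₂ : M, a₁ + a₂ = b₁ + b₂ → ∃ c₁₁ c₁₂ c₂₁ c₂₂ : M,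
    c₁₁ + c₁₂ = a₁ ∧ c₂₁ + c₂₂ = a₂ ∧ c₁₁ + c₂₁ = b₁ ∧ c₁₂ + c₂₂ = b₂

open SetRel

/-! Both sides are equivalent to preservation of weak pullbacks. Positivity and refinability give it
by induction on one of the two functions: refinement splits the other along a sum, positivity
settles zero and point masses. It makes the Barr lifting functorial.

Conversely, an arbitrary extension `L` need not be assumed monotone or to respect converses. The
crux is `lift_inv_graph`: `L` sends the converse of the graph of `f` to the converse of the graph of
its pushforward. Finite supports against infinite fibres prove one inclusion for split surjections;
kernel pairs and coproducts do the rest. Since every relation is a converse graph followed by a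
graph, `L` is the Barr lifting; applied to a cospan, this gives weak pullbacks. -/

/-- Every commuting square of finitely supported functions over a cospan `f : X → Z`, `g : Y → Z`
comes from a finitely supported function on the pullback of `f` and `g`. -/
def PreservesWeakPullbacks (M : Type u) [AddCommMonoid M] : Prop :=
  ∀ ⦃X Y Z : Type u⦄ (f : X → Z) (g : Y → Z) (φ : X →₀ M) (ψ : Y →₀ M),
    φ.mapDomain f = ψ.mapDomain g →
      ∃ N : {p : X × Y // f p.1 = g p.2} →₀ M,
        N.mapDomain (fun p => p.1.1) = φ ∧ N.mapDomain (fun p => p.1.2) = ψ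

/-- A functorial action of `M^(-)` on relations which extends its action on functions. -/
structure RelLifting (M : Type u) [AddCommMonoid M] where
  /-- The relation obtained by lifting `r`. -/
  lift : ∀ {X Y : Type u}, SetRel X Y → SetRel (X →₀ M) (Y →₀ M)
  lift_comp : ∀ {X Y Z : Type u} (r : SetRel X Y) (s : SetRel Y Z),
    lift (r ○ s) = lift r ○ lift s
  lift_graph : ∀ {X Y : Type u} (f : X → Y),
    lift f.graph = Function.graph (Finsupp.mapDomain f)

/-- The Barr extension of `M^(-)` on a relation, in terms of finitely supported functions. -/
def barrLift (M : Type u) [AddCommMonoid M] {X Y : Type u} (r : SetRel X Y) :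
    SetRel (X →₀ M) (Y →₀ M) :=
  {p | ∃ w : r →₀ M, w.mapDomain (fun z => z.1.1) = p.1 ∧ w.mapDomain (fun z => z.1.2) = p.2}

/-! ### Positivity and refinability imply weak pullback preservation -/

namespace IsPositiveMonoid

variable {M : Type u} [AddCommMonoid M]

theorem subsingleton_addUnits (hM : IsPositiveMonoid M) : Subsingleton (AddUnits M) :=
  ⟨fun a b => AddUnits.ext <| by
    rw [(hM _ _ a.val_neg).1, (hM _ _ b.val_neg).1]⟩

theorem mapDomain_apply_eq_zero (hM : IsPositiveMonoid M) {X Y : Type*} {f : X → Y} {φ : X →₀ M}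
    {x : X} (h : φ.mapDomain f (f x) = 0) : φ x = 0 := by
  have := hM.subsingleton_addUnits
  classical
  by_contra hx
  have : f x ∈ (φ.mapDomain f).support := by
    rw [Finsupp.mapDomain_support_of_subsingletonAddUnits]
    exact Finset.mem_image_of_mem f (Finsupp.mem_support_iff.2 hx)
  exact Finsupp.mem_support_iff.1 this h

theorem finsupp_add_eq_zero (hM : IsPositiveMonoid M) {X : Type*} {φ ψ : X →₀ M}
    (h : φ + ψ = 0) : φ = 0 ∧ ψ = 0 := by
  have key := fun x => hM (φ x) (ψ x) (by simpa using DFunLike.congr_fun h x)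
  exact ⟨Finsupp.ext fun x => (key x).1, Finsupp.ext fun x => (key x).2⟩

theorem finsupp_add_eq_single (hM : IsPositiveMonoid M) {X : Type*} {φ ψ : X →₀ M} {x : X} {a : M}
    (h : φ + ψ = Finsupp.single x a) :
    φ = Finsupp.single x (φ x) ∧ ψ = Finsupp.single x (ψ x) := by
  classical
  have key : ∀ y, y ≠ x → φ y = 0 ∧ ψ y = 0 := fun y hy =>
    hM _ _ (by simpa [Finsupp.single_apply, hy.symm] using DFunLike.congr_fun h y)
  constructor <;> ext y <;> by_cases hy : y = x
  · simp [hy]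
  · simp [Ne.symm hy, key y hy]
  · simp [hy]
  · simp [Ne.symm hy, key y hy]

end IsPositiveMonoid

namespace IsRefinableMonoid

variable {M : Type u} [AddCommMonoid M]

theorem finsupp (hR : IsRefinableMonoid M) (X : Type u) : IsRefinableMonoid (X →₀ M) := by
  classical
  intro a₁ a₂ b₁ b₂ h
  choose c₁₁ c₁₂ c₂₁ c₂₂ h₁ h₂ h₃ h₄ using fun x =>
    hR (a₁ x) (a₂ x) (b₁ x) (b₂ x) (by simpa using DFunLike.congr_fun h x)
  let s : Finset X := a₁.support ∪ a₂.support ∪ b₁.support ∪ b₂.support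
  have hs : ∀ x, x ∉ s → a₁ x = 0 ∧ a₂ x = 0 ∧ b₁ x = 0 ∧ b₂ x = 0 := by
    intro x hx
    simpa [s, and_assoc] using hx
  -- Without positivity the chosen matrices may be nonzero where all four sums vanish, so they are
  -- cut off outside `s`.
  let r : (X → M) → X →₀ M := fun c => Finsupp.indicator s fun x _ => c x
  refine ⟨r c₁₁, r c₁₂, r c₂₁, r c₂₂, ?_, ?_, ?_, ?_⟩ <;> ext x <;> by_cases hx : x ∈ s
  all_goals first
    | simp [r, hx, h₁, h₂, h₃, h₄]; done
    | simp [r, hx, hs x hx]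

/-- A decomposition of the image of `ψ` lifts to a decomposition of `ψ`. -/
theorem exists_add_of_mapDomain_eq_add (hR : IsRefinableMonoid M) (hM : IsPositiveMonoid M)
    {Y Z : Type u} (g : Y → Z) (ψ : Y →₀ M) :
    ∀ α β : Z →₀ M, ψ.mapDomain g = α + β →
      ∃ ψ₁ ψ₂, ψ₁ + ψ₂ = ψ ∧ ψ₁.mapDomain g = α ∧ ψ₂.mapDomain g = β := by
  induction ψ using Finsupp.induction_linear with
  | zero =>
    intro α β h
    obtain ⟨rfl, rfl⟩ := hM.finsupp_add_eq_zero (by simpa using h.symm)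
    exact ⟨0, 0, by simp⟩
  | add ψ ψ' ih ih' =>
    intro α β h
    rw [Finsupp.mapDomain_add] at h
    obtain ⟨c₁₁, c₁₂, c₂₁, c₂₂, h₁, h₂, rfl, rfl⟩ := hR.finsupp Z _ _ _ _ h
    obtain ⟨ψ₁, ψ₂, rfl, rfl, rfl⟩ := ih _ _ h₁.symm
    obtain ⟨ψ₁', ψ₂', rfl, rfl, rfl⟩ := ih' _ _ h₂.symm
    exact ⟨ψ₁ + ψ₁', ψ₂ + ψ₂', add_add_add_comm .., Finsupp.mapDomain_add,
      Finsupp.mapDomain_add⟩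
  | single y c =>
    intro α β h
    rw [Finsupp.mapDomain_single] at h
    obtain ⟨hα, hβ⟩ := hM.finsupp_add_eq_single h.symm
    refine ⟨Finsupp.single y (α (g y)), Finsupp.single y (β (g y)), ?_, ?_, ?_⟩
    · rw [← Finsupp.single_add, ← Finsupp.add_apply, ← h, Finsupp.single_eq_same]
    · rw [Finsupp.mapDomain_single, ← hα]
    · rw [Finsupp.mapDomain_single, ← hβ]

theorem preservesWeakPullbacks (hR : IsRefinableMonoid M) (hM : IsPositiveMonoid M) :
    PreservesWeakPullbacks M := by
  classical
  intro X Y Z f g φ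
  induction φ using Finsupp.induction_linear with
  | zero =>
    intro ψ h
    refine ⟨0, by simp, ?_⟩
    ext y
    rw [hM.mapDomain_apply_eq_zero (f := g) (φ := ψ) (x := y) (by simp [← h])]
    simp
  | add φ φ' ih ih' =>
    intro ψ h
    rw [Finsupp.mapDomain_add] at h
    obtain ⟨ψ₁, ψ₂, rfl, h₁, h₂⟩ := hR.exists_add_of_mapDomain_eq_add hM g ψ _ _ h.symm
    obtain ⟨N, rfl, rfl⟩ := ih _ h₁.symm
    obtain ⟨N', rfl, rfl⟩ := ih' _ h₂.symm
    exact ⟨N + N', Finsupp.mapDomain_add, Finsupp.mapDomain_add⟩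
  | single x a =>
    intro ψ h
    rw [Finsupp.mapDomain_single] at h
    -- Positivity confines `ψ` to the fibre of `g` over `f x`, so `ψ` itself, placed on `{x} × g⁻¹(f
    -- x)`, is the witness.
    have hψ : ∀ y ∈ ψ.support, f x = g y := by
      intro y hy
      by_contra hne
      refine Finsupp.mem_support_iff.1 hy (hM.mapDomain_apply_eq_zero (f := g) ?_)
      rw [← h, Finsupp.single_eq_of_ne' hne]
    have hsub : (ψ.subtypeDomain fun y => f x = g y).mapDomain Subtype.val = ψ := by
      conv_rhs => rw [← Finsupp.extendDomain_subtypeDomain ψ hψ,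
        Finsupp.extendDomain_eq_embDomain_subtype, Finsupp.embDomain_eq_mapDomain]
      rfl
    have hsum : ψ.mapDomain (fun _ => x) = Finsupp.single x a := by
      rw [← Finsupp.mapDomain_single (f := fun _ : Z => x) (a := f x), h,
        ← Finsupp.mapDomain_comp]
      rfl
    refine ⟨(ψ.subtypeDomain fun y => f x = g y).mapDomain fun y => ⟨(x, y.1), y.2⟩, ?_, ?_⟩
    · rw [← Finsupp.mapDomain_comp, ← hsum]
      conv_rhs => rw [← hsub]
      rw [← Finsupp.mapDomain_comp]
      rfl
    · rw [← Finsupp.mapDomain_comp]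
      exact hsub

end IsRefinableMonoid

/-! ### Consequences of weak pullback preservation -/

namespace PreservesWeakPullbacks

variable {M : Type u} [AddCommMonoid M]

/-- A two-point set and the empty set over a point have empty pullback. -/
theorem isPositiveMonoid (h : PreservesWeakPullbacks M) : IsPositiveMonoid M := by
  intro a b hab
  obtain ⟨N, h₁, -⟩ := h (fun _ : ULift.{u} Bool => PUnit.unit) (fun y : PEmpty.{u + 1} => y.elim)
    (Finsupp.single ⟨true⟩ a + Finsupp.single ⟨false⟩ b) 0
    (by simp [Finsupp.mapDomain_add, ← Finsupp.single_add, hab])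
  have hN : N = 0 := Finsupp.ext fun p => p.1.2.elim
  rw [hN, Finsupp.mapDomain_zero] at h₁
  have ha := DFunLike.congr_fun h₁ ⟨true⟩
  have hb := DFunLike.congr_fun h₁ ⟨false⟩
  simp at ha hb
  exact ⟨ha.symm, hb.symm⟩

/-- A function on the pullback of two two-point sets over a point is a `2 × 2` matrix; the
projections give its row and column sums. -/
theorem isRefinableMonoid (h : PreservesWeakPullbacks M) : IsRefinableMonoid M := by
  intro a₁ a₂ b₁ b₂ hab
  obtain ⟨N, h₁, h₂⟩ := h (fun _ : ULift.{u} Bool => PUnit.unit)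
    (fun _ : ULift.{u} Bool => PUnit.unit)
    (Finsupp.single ⟨true⟩ a₁ + Finsupp.single ⟨false⟩ a₂)
    (Finsupp.single ⟨true⟩ b₁ + Finsupp.single ⟨false⟩ b₂)
    (by simp [Finsupp.mapDomain_add, ← Finsupp.single_add, hab])
  let N' : Bool × Bool →₀ M := N.mapDomain fun p => (p.1.1.down, p.1.2.down)
  have h₁' : N'.mapDomain Prod.fst = Finsupp.single true a₁ + Finsupp.single false a₂ := by
    have := congrArg (Finsupp.mapDomain ULift.down) h₁
    simp only [← Finsupp.mapDomain_comp, Finsupp.mapDomain_add, Finsupp.mapDomain_single] at this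
    rw [← this, ← Finsupp.mapDomain_comp]
    rfl
  have h₂' : N'.mapDomain Prod.snd = Finsupp.single true b₁ + Finsupp.single false b₂ := by
    have := congrArg (Finsupp.mapDomain ULift.down) h₂
    simp only [← Finsupp.mapDomain_comp, Finsupp.mapDomain_add, Finsupp.mapDomain_single] at this
    rw [← this, ← Finsupp.mapDomain_comp]
    rfl
  have e₁ := DFunLike.congr_fun h₁' true
  have e₂ := DFunLike.congr_fun h₁' false
  have e₃ := DFunLike.congr_fun h₂' true
  have e₄ := DFunLike.congr_fun h₂' false
  simp [Finsupp.mapDomain, Finsupp.sum_fintype, Fintype.sum_prod_type]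
    at e₁ e₂ e₃ e₄
  exact ⟨_, _, _, _, e₁, e₂, e₃, e₄⟩

theorem barrLift_comp (h : PreservesWeakPullbacks M) {X Y Z : Type u} (r : SetRel X Y)
    (s : SetRel Y Z) : barrLift M (r ○ s) = barrLift M r ○ barrLift M s := by
  ext ⟨φ, χ⟩
  constructor
  · rintro ⟨w, rfl, rfl⟩
    choose y hr hs using fun z : ↥(r ○ s) => z.2
    refine ⟨w.mapDomain y, ⟨w.mapDomain fun z => ⟨(z.1.1, y z), hr z⟩, ?_, ?_⟩,
      ⟨w.mapDomain fun z => ⟨(y z, z.1.2), hs z⟩, ?_, ?_⟩⟩ <;>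
    exact Finsupp.mapDomain_comp.symm
  · rintro ⟨ψ, ⟨w, rfl, hw⟩, ⟨v, hv, rfl⟩⟩
    -- The two witnesses agree on `Y`, so they glue over the pullback of `r` and `s`.
    obtain ⟨N, rfl, rfl⟩ := h _ _ w v (hw.trans hv.symm)
    refine ⟨N.mapDomain fun p => ⟨(p.1.1.1.1, p.1.2.1.2), p.1.1.1.2, p.1.1.2, ?_⟩, ?_, ?_⟩
    · have := p.1.2.2
      rwa [← Prod.mk.eta (p := p.1.2.1), ← p.2] at this
    · simp only [← Finsupp.mapDomain_comp]
      rfl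
    · simp only [← Finsupp.mapDomain_comp]
      rfl

end PreservesWeakPullbacks

theorem barrLift_graph (M : Type u) [AddCommMonoid M] {X Y : Type u} (f : X → Y) :
    barrLift M f.graph = Function.graph (Finsupp.mapDomain f) := by
  ext ⟨φ, ψ⟩
  constructor
  · rintro ⟨w, rfl, rfl⟩
    change Finsupp.mapDomain f _ = _
    rw [← Finsupp.mapDomain_comp]
    exact Finsupp.mapDomain_congr fun z _ => z.2
  · rintro (rfl : Finsupp.mapDomain f φ = ψ)
    refine ⟨φ.mapDomain fun x => ⟨(x, f x), rfl⟩, ?_, ?_⟩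
    · rw [← Finsupp.mapDomain_comp]
      exact Finsupp.mapDomain_id
    · rw [← Finsupp.mapDomain_comp]
      rfl

/-! ### Every extension is the Barr extension -/

namespace RelLifting

variable {M : Type u} [AddCommMonoid M] (L : RelLifting M)

theorem mem_lift_graph_comp {X Y Z : Type u} {f : X → Y} {r : SetRel Y Z} {φ : X →₀ M}
    {ψ : Z →₀ M} : (φ, ψ) ∈ L.lift (f.graph ○ r) ↔ (φ.mapDomain f, ψ) ∈ L.lift r := by
  rw [L.lift_comp, L.lift_graph]
  simp

theorem mem_lift_comp_graph {X Y Z : Type u} {r : SetRel X Y} {f : Y → Z} {φ : X →₀ M}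
    {ψ : Z →₀ M} :
    (φ, ψ) ∈ L.lift (r ○ f.graph) ↔ ∃ χ, (φ, χ) ∈ L.lift r ∧ χ.mapDomain f = ψ := by
  rw [L.lift_comp, L.lift_graph]
  simp

theorem lift_inv_graph_comp_graph {X Y : Type u} {f : X → Y} (hf : f.Surjective) :
    L.lift (f.graph.inv ○ f.graph) = SetRel.id := by
  have : f.graph.inv ○ f.graph = Function.graph (id : Y → Y) := by
    ext ⟨y, y'⟩
    constructor
    · rintro ⟨x, hx, hx'⟩
      exact hx.symm.trans hx'
    · rintro rfl
      obtain ⟨x, rfl⟩ := hf y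
      exact ⟨x, rfl, rfl⟩
  rw [this, L.lift_graph]
  ext ⟨φ, ψ⟩
  simp [Finsupp.mapDomain_id]

theorem mapDomain_eq_of_mem_lift_inv_of_surjective {X Y : Type u} {f : X → Y} (hf : f.Surjective)
    {φ : Y →₀ M} {ψ : X →₀ M} (h : (φ, ψ) ∈ L.lift f.graph.inv) : ψ.mapDomain f = φ := by
  have : (φ, ψ.mapDomain f) ∈ L.lift (f.graph.inv ○ f.graph) :=
    L.mem_lift_comp_graph.2 ⟨ψ, h, rfl⟩
  rw [L.lift_inv_graph_comp_graph hf] at this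
  exact this.symm

theorem exists_mem_lift_inv_of_surjective {X Y : Type u} {f : X → Y} (hf : f.Surjective)
    (φ : Y →₀ M) : ∃ ψ, (φ, ψ) ∈ L.lift f.graph.inv := by
  have : (φ, φ) ∈ L.lift (f.graph.inv ○ f.graph) := by
    rw [L.lift_inv_graph_comp_graph hf]
    rfl
  obtain ⟨ψ, h, -⟩ := L.mem_lift_comp_graph.1 this
  exact ⟨ψ, h⟩

/-- The lift of the converse of a split surjection contains the pushforward along the section.
A lift to the infinite fibres of `P × ℕ → X` has finite support, so that it can be moved onto the
section by a map which is still surjective onto `P`. -/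
theorem mem_lift_inv_of_rightInverse {P X : Type u} {p : P → X} {d : X → P}
    (hd : Function.RightInverse d p) (φ : X →₀ M) : (φ, φ.mapDomain d) ∈ L.lift p.graph.inv := by
  classical
  let q : P × ULift.{u} ℕ → X := fun z => p z.1
  have hq : q.Surjective := fun x => ⟨(d x, ⟨0⟩), hd x⟩
  obtain ⟨ψ, hψ⟩ := L.exists_mem_lift_inv_of_surjective hq φ
  let k : P × ULift.{u} ℕ → P := fun z => if z ∈ ψ.support then d (q z) else z.1
  have hk : ∀ z, p (k z) = q z := by
    intro z
    by_cases hz : z ∈ ψ.support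
    · simp only [k, if_pos hz, hd (q z)]
    · simp only [k, if_neg hz, q]
  have hks : k.Surjective := by
    intro z
    obtain ⟨n, hn⟩ := Infinite.exists_notMem_finset (ψ.support.image Prod.snd)
    refine ⟨(z, n), if_neg fun hz => hn ?_⟩
    exact Finset.mem_image_of_mem Prod.snd hz
  -- This holds because `p ∘ k = q` with `k` surjective.
  have hr : p.graph.inv = q.graph.inv ○ k.graph := by
    ext ⟨x, z⟩
    constructor
    · rintro (rfl : p z = x)
      obtain ⟨w, rfl⟩ := hks z
      exact ⟨w, (hk w).symm, rfl⟩
    · rintro ⟨w, (rfl : q w = x), (rfl : k w = z)⟩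
      exact hk w
  rw [hr, L.mem_lift_comp_graph]
  refine ⟨ψ, hψ, ?_⟩
  rw [← L.mapDomain_eq_of_mem_lift_inv_of_surjective hq hψ, ← Finsupp.mapDomain_comp]
  exact Finsupp.mapDomain_congr fun z hz => if_pos hz

/-- The kernel pair of `f` tabulates `f.graph ○ f.graph.inv`, and its first projection is split by
the diagonal. -/
theorem mem_lift_inv_graph {X Y : Type u} (f : X → Y) (ψ : X →₀ M) :
    (ψ.mapDomain f, ψ) ∈ L.lift f.graph.inv := by
  let p : {z : X × X // f z.1 = f z.2} → X := fun z => z.1.1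
  let q : {z : X × X // f z.1 = f z.2} → X := fun z => z.1.2
  let d : X → {z : X × X // f z.1 = f z.2} := fun x => ⟨(x, x), rfl⟩
  have hr : f.graph ○ f.graph.inv = p.graph.inv ○ q.graph := by
    ext ⟨x, x'⟩
    constructor
    · rintro ⟨y, rfl, hy⟩
      exact ⟨⟨(x, x'), hy.symm⟩, rfl, rfl⟩
    · rintro ⟨z, (rfl : z.1.1 = x), (rfl : z.1.2 = x')⟩
      exact ⟨_, rfl, z.2.symm⟩
  rw [← L.mem_lift_graph_comp, hr, L.mem_lift_comp_graph]
  refine ⟨ψ.mapDomain d, L.mem_lift_inv_of_rightInverse (fun _ => rfl) ψ, ?_⟩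
  rw [← Finsupp.mapDomain_comp]
  exact Finsupp.mapDomain_id

/-- Adjoining a copy of `Y` to `X` makes `f` a surjection `g = c ∘ k`. The fold map `c` is split by
`Sum.inl`, and the square `hsq` carries the hypothesis on `f` over to `k`. -/
theorem mapDomain_eq_of_mem_lift_inv {X Y : Type u} {f : X → Y} {φ : Y →₀ M} {ψ : X →₀ M}
    (h : (φ, ψ) ∈ L.lift f.graph.inv) : ψ.mapDomain f = φ := by
  let g : X ⊕ Y → Y := Sum.elim f id
  let k : X ⊕ Y → Y ⊕ Y := Sum.map f id
  let c : Y ⊕ Y → Y := Sum.elim id id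
  have hg : g.Surjective := fun y => ⟨.inr y, rfl⟩
  have hsq : (Sum.inl : Y → Y ⊕ Y).graph ○ k.graph.inv =
      f.graph.inv ○ (Sum.inl : X → X ⊕ Y).graph := by
    ext ⟨y, z⟩
    rcases z with x | y' <;> simp [k, eq_comm]
  have hcomp : g.graph.inv = c.graph.inv ○ k.graph.inv := by
    ext ⟨y, z⟩
    rcases z with x | y' <;> simp [g, c, k]
  have h₁ : (φ.mapDomain Sum.inl, ψ.mapDomain Sum.inl) ∈ L.lift k.graph.inv := by
    rw [← L.mem_lift_graph_comp, hsq, L.mem_lift_comp_graph]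
    exact ⟨ψ, h, rfl⟩
  have h₂ : (φ, φ.mapDomain Sum.inl) ∈ L.lift c.graph.inv :=
    L.mem_lift_inv_of_rightInverse (fun _ => rfl) φ
  have h₃ : (φ, ψ.mapDomain Sum.inl) ∈ L.lift g.graph.inv := by
    rw [hcomp, L.lift_comp]
    exact ⟨_, h₂, h₁⟩
  rw [← L.mapDomain_eq_of_mem_lift_inv_of_surjective hg h₃, ← Finsupp.mapDomain_comp]
  rfl

theorem lift_inv_graph {X Y : Type u} (f : X → Y) :
    L.lift f.graph.inv = (Function.graph (Finsupp.mapDomain f)).inv := by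
  ext ⟨φ, ψ⟩
  constructor
  · exact L.mapDomain_eq_of_mem_lift_inv
  · rintro (rfl : Finsupp.mapDomain f ψ = φ)
    exact L.mem_lift_inv_graph f ψ

theorem lift_eq_barrLift {X Y : Type u} (r : SetRel X Y) : L.lift r = barrLift M r := by
  have hr : r = (Function.graph fun z : r => z.1.1).inv ○ Function.graph fun z : r => z.1.2 := by
    ext ⟨x, y⟩
    constructor
    · exact fun h => ⟨⟨(x, y), h⟩, rfl, rfl⟩
    · rintro ⟨z, (rfl : z.1.1 = x), (rfl : z.1.2 = y)⟩
      exact z.2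
  conv_lhs => rw [hr, L.lift_comp, L.lift_inv_graph, L.lift_graph]
  rfl

theorem preservesWeakPullbacks {M : Type u} [AddCommMonoid M] (L : RelLifting M) :
    PreservesWeakPullbacks M := by
  intro X Y Z f g φ ψ h
  have hr : f.graph ○ g.graph.inv =
      (Function.graph fun p : {p : X × Y // f p.1 = g p.2} => p.1.1).inv ○
        Function.graph fun p => p.1.2 := by
    ext ⟨x, y⟩
    constructor
    · rintro ⟨z, rfl, hz⟩
      exact ⟨⟨(x, y), hz.symm⟩, rfl, rfl⟩
    · rintro ⟨p, (rfl : p.1.1 = x), (rfl : p.1.2 = y)⟩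
      exact ⟨_, rfl, p.2.symm⟩
  have hmem : (φ, ψ) ∈ L.lift (f.graph ○ g.graph.inv) := by
    rw [L.mem_lift_graph_comp, h]
    exact L.mem_lift_inv_graph g ψ
  rw [hr, L.lift_comp, L.lift_inv_graph, L.lift_graph] at hmem
  exact hmem

end RelLifting

/-- The Barr extension of `M^(-)`, if `M^(-)` preserves weak pullbacks. -/
def PreservesWeakPullbacks.relLifting {M : Type u} [AddCommMonoid M]
    (h : PreservesWeakPullbacks M) : RelLifting M where
  lift := barrLift M
  lift_comp := h.barrLift_comp
  lift_graph := barrLift_graph M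

/-! ### From liftings to endofunctors of `Rel` and back -/

namespace RelLifting

variable {M : Type u} [AddCommMonoid M]

theorem lift_id (L : RelLifting M) (X : Type u) :
    L.lift (SetRel.id : SetRel X X) = SetRel.id := by
  rw [← Function.graph_id, L.lift_graph]
  ext ⟨φ, ψ⟩
  simp [Finsupp.mapDomain_id]

/-- The endofunctor of `Rel` given by a relation lifting. -/
noncomputable def toFunctor (L : RelLifting M) : RelCat.{u} ⥤ RelCat.{u} where
  obj X := RelCat.graphFunctor.obj ((monoidValued M).obj X)
  map r := RelCat.Hom.ofRel (L.lift r.rel)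
  map_id X := RelCat.Hom.ext _ _ (L.lift_id X)
  map_comp r s := RelCat.Hom.ext _ _ (L.lift_comp r.rel s.rel)

theorem isRelExtension_toFunctor (L : RelLifting M) :
    IsRelExtension (monoidValued M) L.toFunctor :=
  Functor.hext (fun _ => rfl) fun _ _ f =>
    heq_of_eq <| RelCat.Hom.ext _ _ <| L.lift_graph f

theorem toFunctor_toPrefunctor (L : RelLifting M) :
    L.toFunctor.toPrefunctor = barrExtension (monoidValued M) := by
  refine congrArg (Prefunctor.mk _) ?_
  funext X Y r
  exact RelCat.Hom.ext _ _ (L.lift_eq_barrLift r.rel)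

theorem exists_toFunctor_eq {E : RelCat.{u} ⥤ RelCat.{u}}
    (hE : IsRelExtension (monoidValued M) E) : ∃ L : RelLifting M, E = L.toFunctor := by
  obtain ⟨obj, map, hid, hcomp⟩ := E
  have hobj : obj = fun X => RelCat.graphFunctor.obj ((monoidValued M).obj X) :=
    funext fun X => Functor.congr_obj hE X
  -- Once the object parts coincide definitionally, the heterogeneous equalities of morphisms become
  -- plain ones.
  subst hobj
  refine ⟨⟨fun {X Y} r => (map (X := X) (Y := Y) (RelCat.Hom.ofRel r)).rel, ?_, ?_⟩, rfl⟩
  · intro X Y Z r s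
    exact congrArg RelCat.Hom.rel
      (@hcomp X Y Z (RelCat.Hom.ofRel r) (RelCat.Hom.ofRel s))
  · intro X Y f
    exact congrArg RelCat.Hom.rel (eq_of_heq (Functor.hcongr_hom hE (TypeCat.ofHom f)))

end RelLifting

theorem mainTheorem4 (M : Type u) [AddCommMonoid M] :
    ((∃ E : RelCat.{u} ⥤ RelCat.{u}, IsRelExtension (monoidValued M) E) ↔
      IsPositiveMonoid M ∧ IsRefinableMonoid M) ∧
    (IsPositiveMonoid M ∧ IsRefinableMonoid M →
      ∃ E : RelCat.{u} ⥤ RelCat.{u},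
        IsRelExtension (monoidValued M) E ∧
        E.toPrefunctor = barrExtension (monoidValued M) ∧
        ∀ E' : RelCat.{u} ⥤ RelCat.{u}, IsRelExtension (monoidValued M) E' → E' = E) := by
  refine ⟨⟨?_, ?_⟩, ?_⟩
  · rintro ⟨E, hE⟩
    obtain ⟨L, -⟩ := RelLifting.exists_toFunctor_eq hE
    exact ⟨L.preservesWeakPullbacks.isPositiveMonoid, L.preservesWeakPullbacks.isRefinableMonoid⟩
  · rintro ⟨hM, hR⟩
    exact ⟨_, (hR.preservesWeakPullbacks hM).relLifting.isRelExtension_toFunctor⟩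
  · rintro ⟨hM, hR⟩
    let B := (hR.preservesWeakPullbacks hM).relLifting
    refine ⟨B.toFunctor, B.isRelExtension_toFunctor, B.toFunctor_toPrefunctor, fun E' hE' => ?_⟩
    obtain ⟨L, rfl⟩ := RelLifting.exists_toFunctor_eq hE'
    refine Functor.hext (fun _ => rfl) fun _ _ r => heq_of_eq <| RelCat.Hom.ext _ _ ?_
    exact (L.lift_eq_barrLift r.rel).trans (B.lift_eq_barrLift r.rel).symm
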